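/- Let $V$ be a finite set. A weighted oriented graph $D$ on $V$ consists of a set $E(D)\subset V\times V$ of directed edges, containing no loop and never both $(u,v)$ and $(v,u)$, and a weight function $w\colon V\to\{1,2,3,\ldots\}$; its underlying graph $G$ is the simple graph on $V$ with edges $\{u,v\}$ for $(u,v)\in E(D)$. A vertex is a source if it has no incoming edge and a sink if it has no outgoing edge. As usual, assume that every source that is not an isolated vertex has weight $1$. Let $K$ be a field, let $S=K[t_v : v\in V]$, let $$I(D)=\bigl(t_u t_v^{w(v)} : (u,v)\in E(D)\bigr)\subset S$$ be the edge ideal of $D$, and for $n\geq 1$ let $$I(D)^{(n)}=\bigcap_{\mathfrak p}\bigl(I(D)^nS_{\mathfrak p}\cap S\bigr)$$ be its $n$-th symbolic power, where $\mathfrak p$ runs over the minimal primes of $I(D)$ and $J\cap S$ denotes the preimage of $J\subset S_{\mathfrak p}$ in $S$. Then $I(D)^n=I(D)^{(n)}$ for all $n\geq 1$ if and only if the following two conditions hold: (a) every vertex $v$ with $w(v)>1$ is a sink; (b) $G$ is bipartite. -/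

import Mathlib

/-- A weighted oriented graph on the vertex set `V`: every edge `u → v` is directed, no edge is
present in both directions (in particular there are no loops), and every vertex carries a weight,
a positive integer. -/
structure WeightedOrientedGraph (V : Type*) where
  /-- `Edge u v` says that `(u, v)` is an edge, directed from `u` to `v`. -/
  Edge : V → V → Prop
  asymm : ∀ u v, Edge u v → ¬ Edge v u
  weight : V → ℕ
  weight_pos : ∀ v, 1 ≤ weight v

namespace WeightedOrientedGraph

variable {V : Type*}

/-- The underlying simple graph, obtained by forgetting directions and weights. -/
def underlyingGraph (D : WeightedOrientedGraph V) : SimpleGraph V where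
  Adj u v := D.Edge u v ∨ D.Edge v u
  symm := ⟨fun _ _ h => h.symm⟩
  loopless := ⟨fun v h => h.elim (fun e => D.asymm v v e e) (fun e => D.asymm v v e e)⟩

/-- A source is a vertex with only outgoing edges. -/
def IsSource (D : WeightedOrientedGraph V) (v : V) : Prop :=
  ∀ u, ¬ D.Edge u v

/-- A sink is a vertex with only incoming edges. -/
def IsSink (D : WeightedOrientedGraph V) (v : V) : Prop :=
  ∀ u, ¬ D.Edge v u

/-- The set `V⁺(D)` of vertices of weight greater than one. -/
def heavyVertices (D : WeightedOrientedGraph V) : Set V :=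
  {v | 1 < D.weight v}

/-- The edge ideal of `D`, generated by the monomials `t_u * t_v ^ w(v)` for the directed edges
`(u, v)`, in the polynomial ring over `K` whose variables are the vertices. -/
noncomputable def edgeIdeal (K : Type*) [Field K] (D : WeightedOrientedGraph V) :
    Ideal (MvPolynomial V K) :=
  Ideal.span {f | ∃ u v, D.Edge u v ∧ f = MvPolynomial.X u * MvPolynomial.X v ^ D.weight v}

end WeightedOrientedGraph

/-- The contraction `J R_p ∩ R` to `R` of the extension of the ideal `J` to the localization of
`R` at the prime ideal `p`. -/
noncomputable def localContraction {R : Type*} [CommRing R] (J p : Ideal R) [p.IsPrime] :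
    Ideal R :=
  (J.map (algebraMap R (Localization.AtPrime p))).comap (algebraMap R (Localization.AtPrime p))

/-- The `n`-th symbolic power of `I`, defined with the minimal primes of `I`: the intersection of
the ideals `I ^ n R_p ∩ R`, where `p` runs over the minimal primes of `I`. -/
noncomputable def symbolicPower {R : Type*} [CommRing R] (I : Ideal R) (n : ℕ) : Ideal R :=
  ⨅ p : I.minimalPrimes,
    haveI : p.1.IsPrime := p.2.1.1
    localContraction (I ^ n) p.1

/-! Minimal primes of `I(D)` are generated by the variables of vertex covers, so membership in a
symbolic power can be tested on exponents, one cover at a time.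

If all heavy vertices are sinks, every generator is `t_u ^ w(u) * t_v ^ w(v)`. An exponent `a` of a
polynomial in the `n`-th symbolic power then satisfies `n ≤ ∑ v ∈ C, ⌊a v / w v⌋` for every vertex
cover `C` (`le_sum_div_of_mem_symbolicPower`). When `G` is bipartite, König's theorem with
capacities `⌊a v / w v⌋` turns this into `n` edges whose generators multiply to a divisor of `t ^
a`.

Conversely, each failure gives an explicit monomial in a symbolic power but not in the ordinary one:
a path `x → v → u` through a heavy `v`, or, once heavy vertices are sinks, an odd closed walk. -/

/-! ### Symbolic powers through localization -/

theorem mem_localContraction {R : Type*} [CommRing R] {J p : Ideal R} [p.IsPrime] {f : R} :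
    f ∈ localContraction J p ↔ ∃ s ∉ p, s * f ∈ J := by
  rw [localContraction, Ideal.mem_comap,
    IsLocalization.algebraMap_mem_map_algebraMap_iff p.primeCompl]
  rfl

theorem mem_symbolicPower {R : Type*} [CommRing R] {I : Ideal R} {n : ℕ} {f : R} :
    f ∈ symbolicPower I n ↔ ∀ p ∈ I.minimalPrimes, ∃ s ∉ p, s * f ∈ I ^ n := by
  simp only [symbolicPower, Ideal.mem_iInf, mem_localContraction, Subtype.forall]

theorem pow_le_symbolicPower {R : Type*} [CommRing R] (I : Ideal R) (n : ℕ) :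
    I ^ n ≤ symbolicPower I n := fun f hf =>
  mem_symbolicPower.2 fun _ hp => ⟨1, (Ideal.ne_top_iff_one _).1 hp.1.1.ne_top, by simpa using hf⟩

section localContraction

variable {R : Type*} [CommRing R] {I p : Ideal R} [p.IsPrime]

theorem localContraction_pow_mul_mem {m n : ℕ} {f g : R} (hf : f ∈ localContraction (I ^ m) p)
    (hg : g ∈ localContraction (I ^ n) p) : f * g ∈ localContraction (I ^ (m + n)) p := by
  obtain ⟨s, hs, hsf⟩ := mem_localContraction.1 hf
  obtain ⟨t, ht, htg⟩ := mem_localContraction.1 hg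
  refine mem_localContraction.2 ⟨s * t, p.primeCompl.mul_mem hs ht, ?_⟩
  rw [pow_add, mul_mul_mul_comm]
  exact Ideal.mul_mem_mul hsf htg

theorem one_mem_localContraction_pow_zero : (1 : R) ∈ localContraction (I ^ 0) p :=
  mem_localContraction.2 ⟨1, p.primeCompl.one_mem, by simp⟩

theorem localContraction_prod_mem {ι : Type*} (s : Finset ι) (k : ι → ℕ) (f : ι → R)
    (h : ∀ i ∈ s, f i ∈ localContraction (I ^ k i) p) :
    ∏ i ∈ s, f i ∈ localContraction (I ^ ∑ i ∈ s, k i) p := by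
  classical
  induction s using Finset.induction_on with
  | empty => simpa using one_mem_localContraction_pow_zero (I := I) (p := p)
  | insert a s ha ih =>
    rw [Finset.prod_insert ha, Finset.sum_insert ha]
    exact localContraction_pow_mul_mem (h a (Finset.mem_insert_self a s))
      (ih fun i hi => h i (Finset.mem_insert_of_mem hi))

theorem localContraction_pow_mem {f : R} (hf : f ∈ localContraction I p) (n : ℕ) :
    f ^ n ∈ localContraction (I ^ n) p := by
  simpa using localContraction_prod_mem (I := I) (p := p) (Finset.range n) (fun _ => 1)
    (fun _ => f) (by simpa using fun _ _ => hf)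

theorem localContraction_pow_antitone {m n : ℕ} (h : m ≤ n) {f : R}
    (hf : f ∈ localContraction (I ^ n) p) : f ∈ localContraction (I ^ m) p := by
  obtain ⟨s, hs, hsf⟩ := mem_localContraction.1 hf
  exact mem_localContraction.2 ⟨s, hs, Ideal.pow_le_pow_right h hsf⟩

end localContraction

/-! ### Primes generated by variables -/

namespace MvPolynomial

/-- The ideal is the kernel of the endomorphism that kills the variables in `C`, and the target is a
domain. -/
theorem isPrime_span_X_image {σ K : Type*} [Field K] (C : Set σ) :
    (Ideal.span (X '' C : Set (MvPolynomial σ K))).IsPrime := by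
  classical
  set P := Ideal.span (X '' C : Set (MvPolynomial σ K)) with hP
  let φ : MvPolynomial σ K →ₐ[K] MvPolynomial σ K := aeval fun v => if v ∈ C then 0 else X v
  have hmk : (Ideal.Quotient.mkₐ K P).comp φ = Ideal.Quotient.mkₐ K P := by
    ext v
    by_cases hv : v ∈ C
    · have : Ideal.Quotient.mk P (X v) = 0 :=
        Ideal.Quotient.eq_zero_iff_mem.2 (Ideal.subset_span ⟨v, hv, rfl⟩)
      simp [φ, hv, this]
    · simp [φ, hv]
  have hker : P = RingHom.ker φ.toRingHom := by
    apply le_antisymm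
    · rw [hP, Ideal.span_le]
      rintro _ ⟨v, hv, rfl⟩
      simp [φ, hv, RingHom.mem_ker]
    · intro f hf
      have h : φ f = 0 := hf
      have := DFunLike.congr_fun hmk f
      rw [AlgHom.comp_apply, h, map_zero] at this
      exact Ideal.Quotient.eq_zero_iff_mem.1 this.symm
  rw [hker]
  exact RingHom.ker_isPrime _

/-- The exponents of weight less than `n`, for a weight with values in `ℕ` that ignores the
variables outside `C`, cannot be cleared by multiplying with a polynomial outside the prime
generated by the variables in `C`. -/
theorem le_of_mul_support {σ K : Type*} [Finite σ] [Field K] (C : Set σ)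
    (φ : (σ →₀ ℕ) → ℕ) (hmono : Monotone φ)
    (hφ : ∀ c b : σ →₀ ℕ, (∀ v ∈ C, c v = 0) → φ (c + b) = φ b) {n : ℕ}
    {s f : MvPolynomial σ K} (hs : s ∉ Ideal.span (X '' C : Set (MvPolynomial σ K)))
    (hsf : ∀ a ∈ (s * f).support, n ≤ φ a) : ∀ a ∈ f.support, n ≤ φ a := by
  classical
  have := Fintype.ofFinite σ
  by_contra! hbad
  let δ : (σ →₀ ℕ) → ℕ := fun a => ∑ v with v ∈ C, a v
  have hδ : ∀ a b, δ (a + b) = δ a + δ b := fun a b => by simp [δ, Finset.sum_add_distrib]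
  have hδ0 : ∀ a, δ a = 0 ↔ ∀ v ∈ C, a v = 0 := fun a => by simp [δ]
  let F := f.support.filter fun a => φ a < n
  have hF : F.Nonempty := by
    obtain ⟨a, ha, han⟩ := hbad
    exact ⟨a, Finset.mem_filter.2 ⟨ha, han⟩⟩
  obtain ⟨m, hm, hmin⟩ := Finset.exists_min_image F δ hF
  let A := s.support.filter fun c => δ c = 0
  let B := F.filter fun b => δ b = δ m
  have hA : A.Nonempty := by
    rw [mem_ideal_span_X_image] at hs
    push Not at hs
    obtain ⟨c, hc, hc0⟩ := hs
    exact ⟨c, Finset.mem_filter.2 ⟨hc, (hδ0 c).2 hc0⟩⟩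
  -- `A` holds the exponents of `s` free of `C`, `B` the bad exponents of `f` of least degree in
  -- `C`. A sum attained only once on `A × B` cannot cancel in `s * f`: any other pair with this sum
  -- has a bad second entry by monotonicity of `φ`, and minimality of the degree puts it back in `A
  -- × B`.
  obtain ⟨a, ha, b, hb, hu⟩ :=
    UniqueSums.uniqueAdd_of_nonempty hA (⟨m, Finset.mem_filter.2 ⟨hm, rfl⟩⟩ : B.Nonempty)
  obtain ⟨has, ha0⟩ := Finset.mem_filter.1 ha
  obtain ⟨hbF, hbm⟩ := Finset.mem_filter.1 hb
  obtain ⟨hbf, hbn⟩ := Finset.mem_filter.1 hbF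
  have hab : φ (a + b) = φ b := hφ a b ((hδ0 a).1 ha0)
  have hcoeff : coeff (a + b) (s * f) = coeff a s * coeff b f := by
    rw [coeff_mul]
    refine Finset.sum_eq_single (a, b) ?_ (by simp)
    rintro ⟨c, d⟩ hcd hne
    replace hcd : c + d = a + b := by simpa using hcd
    by_contra h0
    have hc : c ∈ s.support := mem_support_iff.2 (left_ne_zero_of_mul h0)
    have hd : d ∈ f.support := mem_support_iff.2 (right_ne_zero_of_mul h0)
    have hdF : d ∈ F := by
      refine Finset.mem_filter.2 ⟨hd, lt_of_le_of_lt (hmono ?_) (hab.trans_lt hbn)⟩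
      simp only [← hcd]
      exact le_add_self
    have h1 := hmin d hdF
    have h2 : δ c + δ d = δ a + δ b := by rw [← hδ, ← hδ]; exact congrArg δ hcd
    obtain ⟨rfl, rfl⟩ := hu (Finset.mem_filter.2 ⟨hc, by omega⟩)
      (Finset.mem_filter.2 ⟨hdF, by omega⟩) hcd
    exact hne rfl
  have := hsf (a + b) <| mem_support_iff.2 <| by
    rw [hcoeff]
    exact mul_ne_zero (mem_support_iff.1 has) (mem_support_iff.1 hbf)
  omega

end MvPolynomial

/-! ### Powers and minimal primes of the edge ideal -/

namespace WeightedOrientedGraph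

open MvPolynomial

variable {V : Type*} (D : WeightedOrientedGraph V) {K : Type*} [Field K]

/-- The exponent of the generator of the edge ideal attached to the edge `e`. -/
noncomputable def edgeExponent (e : V × V) : V →₀ ℕ :=
  Finsupp.single e.1 1 + Finsupp.single e.2 (D.weight e.2)

/-- The exponents of the products of `n` generators of the edge ideal. -/
def powExponents (n : ℕ) : Set (V →₀ ℕ) :=
  {a | ∃ e : Fin n → V × V, (∀ i, D.Edge (e i).1 (e i).2) ∧ a = ∑ i, D.edgeExponent (e i)}

variable {D}

theorem monomial_edgeExponent (u v : V) :
    monomial (D.edgeExponent (u, v)) (1 : K) = X u * X v ^ D.weight v := by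
  rw [X_pow_eq_monomial, X, monomial_mul, mul_one, edgeExponent]

theorem edgeIdeal_pow_eq_span (n : ℕ) :
    D.edgeIdeal K ^ n = Ideal.span ((fun a => monomial a (1 : K)) '' D.powExponents n) := by
  induction n with
  | zero =>
    have : D.powExponents 0 = {0} := by
      ext a
      simp [powExponents]
    rw [this, Set.image_singleton, pow_zero, Ideal.one_eq_top, monomial_zero', C_1,
      Ideal.span_singleton_one]
  | succ n ih =>
    rw [pow_succ', ih, edgeIdeal, Ideal.span_mul_span']
    congr 1
    ext f
    constructor
    · rintro ⟨_, ⟨u, v, huv, rfl⟩, _, ⟨_, ⟨e, he, rfl⟩, rfl⟩, rfl⟩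
      refine ⟨_, ⟨Fin.cons (u, v) e, Fin.cases (by simpa using huv) (by simpa using he), rfl⟩, ?_⟩
      simp [Fin.sum_univ_succ, ← monomial_edgeExponent, monomial_mul]
    · rintro ⟨_, ⟨e, he, rfl⟩, rfl⟩
      refine Set.mem_mul.2 ⟨_, ⟨(e 0).1, (e 0).2, he 0, rfl⟩, _, Set.mem_image_of_mem _
        ⟨fun i => e (Fin.succ i), fun i => he (Fin.succ i), rfl⟩, ?_⟩
      simp [Fin.sum_univ_succ, ← monomial_edgeExponent, monomial_mul]

theorem edgeExponent_eq (hw : ∀ u v, D.Edge u v → D.weight u = 1) {e : V × V}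
    (he : D.Edge e.1 e.2) :
    D.edgeExponent e = Finsupp.single e.1 (D.weight e.1) + Finsupp.single e.2 (D.weight e.2) := by
  rw [edgeExponent, hw _ _ he]

theorem mem_edgeIdeal_pow {n : ℕ} {f : MvPolynomial V K} :
    f ∈ D.edgeIdeal K ^ n ↔ ∀ a ∈ f.support, ∃ e : Fin n → V × V,
      (∀ i, D.Edge (e i).1 (e i).2) ∧ ∑ i, D.edgeExponent (e i) ≤ a := by
  rw [edgeIdeal_pow_eq_span, mem_ideal_span_monomial_image]
  refine forall₂_congr fun a _ => ⟨?_, ?_⟩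
  · rintro ⟨_, ⟨e, he, rfl⟩, h⟩
    exact ⟨e, he, h⟩
  · rintro ⟨e, he, h⟩
    exact ⟨_, ⟨e, he, rfl⟩, h⟩

theorem monomial_mem_edgeIdeal_pow {n : ℕ} {a : V →₀ ℕ} :
    monomial a (1 : K) ∈ D.edgeIdeal K ^ n ↔ ∃ e : Fin n → V × V,
      (∀ i, D.Edge (e i).1 (e i).2) ∧ ∑ i, D.edgeExponent (e i) ≤ a := by
  classical
  rw [mem_edgeIdeal_pow, support_monomial, if_neg one_ne_zero]
  simp

theorem mul_mem_edgeIdeal {u v : V} (h : D.Edge u v) :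
    (X u * X v ^ D.weight v : MvPolynomial V K) ∈ D.edgeIdeal K :=
  Ideal.subset_span ⟨u, v, h, rfl⟩

theorem edgeIdeal_le_span_X_image {C : Set V} (hC : ∀ u v, D.Edge u v → u ∈ C ∨ v ∈ C) :
    D.edgeIdeal K ≤ Ideal.span (X '' C) := by
  rw [edgeIdeal, Ideal.span_le]
  rintro _ ⟨u, v, huv, rfl⟩
  rcases hC u v huv with h | h
  · exact Ideal.mul_mem_right _ _ (Ideal.subset_span ⟨u, h, rfl⟩)
  · exact Ideal.mul_mem_left _ _ (Ideal.pow_mem_of_mem _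
      (Ideal.subset_span (Set.mem_image_of_mem _ h)) _ (D.weight_pos v))

variable {p : Ideal (MvPolynomial V K)}

theorem X_mem_or_X_mem (hp : p ∈ (D.edgeIdeal K).minimalPrimes) {u v : V} (h : D.Edge u v) :
    (X u : MvPolynomial V K) ∈ p ∨ (X v : MvPolynomial V K) ∈ p :=
  (hp.1.1.mem_or_mem (hp.1.2 (mul_mem_edgeIdeal h))).imp_right (hp.1.1.mem_of_pow_mem _)

theorem span_X_le_of_le (C : Set V) (h : ∀ v ∈ C, (X v : MvPolynomial V K) ∈ p) :
    Ideal.span (X '' C) ≤ p := by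
  rw [Ideal.span_le]
  rintro _ ⟨v, hv, rfl⟩
  exact h v hv

/-- The variables in `p` already meet every edge, so they generate a prime between `I(D)` and `p`.
-/
theorem eq_span_X_of_mem_minimalPrimes (hp : p ∈ (D.edgeIdeal K).minimalPrimes) :
    p = Ideal.span (X '' {v | (X v : MvPolynomial V K) ∈ p}) :=
  le_antisymm
    (hp.2 ⟨isPrime_span_X_image _, edgeIdeal_le_span_X_image fun _ _ h => X_mem_or_X_mem hp h⟩
      (span_X_le_of_le _ fun _ h => h))
    (span_X_le_of_le _ fun _ h => h)

theorem X_mem_span_X_image {C : Set V} {v : V} :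
    (X v : MvPolynomial V K) ∈ Ideal.span (X '' C) ↔ v ∈ C := by
  classical
  rw [mem_ideal_span_X_image, support_X]
  simp [Finsupp.single_apply]

/-- Otherwise `v` could be dropped from the cover, contradicting minimality. -/
theorem exists_adj_X_notMem (hp : p ∈ (D.edgeIdeal K).minimalPrimes) {v : V}
    (hv : (X v : MvPolynomial V K) ∈ p) :
    ∃ u, D.underlyingGraph.Adj v u ∧ (X u : MvPolynomial V K) ∉ p := by
  by_contra! h
  have hle : p ≤ Ideal.span (X '' ({u | (X u : MvPolynomial V K) ∈ p} \ {v})) := by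
    refine hp.2 ⟨isPrime_span_X_image _, edgeIdeal_le_span_X_image fun a b hab => ?_⟩
      (span_X_le_of_le _ fun _ h => h.1)
    have hne : a ≠ b := fun hab' => D.asymm a b hab (hab' ▸ hab' ▸ hab)
    rcases eq_or_ne a v with rfl | ha
    · exact Or.inr ⟨h b (Or.inl hab), hne.symm⟩
    rcases eq_or_ne b v with rfl | hb
    · exact Or.inl ⟨h a (Or.inr hab), ha⟩
    exact (X_mem_or_X_mem hp hab).imp (⟨·, ha⟩) (⟨·, hb⟩)
  exact (X_mem_span_X_image.1 (hle hv)).2 rfl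

section localContraction

variable [p.IsPrime]

theorem X_mem_localContraction {u v : V} (h : D.Edge u v) (hv : (X v : MvPolynomial V K) ∉ p) :
    (X u : MvPolynomial V K) ∈ localContraction (D.edgeIdeal K) p :=
  mem_localContraction.2
    ⟨X v ^ D.weight v, p.primeCompl.pow_mem hv _, by rw [mul_comm]; exact mul_mem_edgeIdeal h⟩

theorem X_pow_mem_localContraction (hp : p ∈ (D.edgeIdeal K).minimalPrimes) {v : V}
    (hv : (X v : MvPolynomial V K) ∈ p) :
    (X v ^ D.weight v : MvPolynomial V K) ∈ localContraction (D.edgeIdeal K) p := by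
  obtain ⟨u, huv | huv, hu⟩ := exists_adj_X_notMem hp hv
  · exact Ideal.pow_mem_of_mem _ (X_mem_localContraction huv hu) _ (D.weight_pos v)
  · exact mem_localContraction.2 ⟨X u, hu, mul_mem_edgeIdeal huv⟩

end localContraction

/-- The exponents of the polynomials in a symbolic power satisfy the inequality attached to each
vertex cover. -/
theorem le_sum_div_of_mem_symbolicPower [Fintype V]
    (hw : ∀ u v, D.Edge u v → D.weight u = 1) {n : ℕ} {f : MvPolynomial V K}
    (hf : f ∈ symbolicPower (D.edgeIdeal K) n) (C : Finset V)
    (hC : ∀ u v, D.Edge u v → u ∈ C ∨ v ∈ C) :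
    ∀ a ∈ f.support, n ≤ ∑ v ∈ C, a v / D.weight v := by
  classical
  have := isPrime_span_X_image (K := K) (C : Set V)
  obtain ⟨p, hp, hpC⟩ := Ideal.exists_minimalPrimes_le
    (edgeIdeal_le_span_X_image (K := K) (C := (C : Set V)) hC)
  obtain ⟨s, hs, hsf⟩ := mem_symbolicPower.1 hf p hp
  rw [eq_span_X_of_mem_minimalPrimes hp] at hs
  set C' : Finset V := Finset.univ.filter fun v => (X v : MvPolynomial V K) ∈ p with hC'
  have hCC : C' ⊆ C := fun v hv =>
    X_mem_span_X_image.1 (hpC (Finset.mem_filter.1 hv).2)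
  have key := le_of_mul_support (K := K) {v | (X v : MvPolynomial V K) ∈ p}
    (fun a : V →₀ ℕ => ∑ v ∈ C', a v / D.weight v)
    (fun a b hab => Finset.sum_le_sum fun v _ => Nat.div_le_div_right (hab v))
    (fun c b hc => Finset.sum_congr rfl fun v hv => by
      rw [Finsupp.add_apply, hc v (Finset.mem_filter.1 hv).2, zero_add]) (n := n) (f := f) hs ?_
  · exact fun a ha => (key a ha).trans (Finset.sum_le_sum_of_subset hCC)
  intro a ha
  obtain ⟨e, he, hea⟩ := mem_edgeIdeal_pow.1 hsf a ha
  -- Each edge is charged to one endpoint in the cover. It contributes a full `w v` to the exponent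
  -- there, so the bound survives rounding down.
  let c : Fin n → V := fun i => if (X (e i).1 : MvPolynomial V K) ∈ p then (e i).1 else (e i).2
  have hc : ∀ i, c i ∈ C' := fun i => by
    simp only [c, hC', Finset.mem_filter, Finset.mem_univ, true_and]
    split_ifs with h
    · exact h
    · exact (X_mem_or_X_mem hp (he i)).resolve_left h
  calc n = ∑ v ∈ C', (Finset.univ.filter fun i => c i = v).card := by
        rw [← Finset.card_eq_sum_card_fiberwise fun i _ => hc i]; simp
    _ ≤ _ := Finset.sum_le_sum fun v hv => ?_
  rw [Nat.le_div_iff_mul_le (D.weight_pos v)]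
  refine le_trans ?_ (hea v)
  rw [Finsupp.finsetSum_apply, ← smul_eq_mul, ← Finset.sum_const, Finset.sum_filter]
  refine Finset.sum_le_sum fun i _ => ?_
  rw [edgeExponent_eq hw (he i), Finsupp.add_apply]
  split_ifs with h
  · simp only [c] at h
    split_ifs at h
    · simp [h]
    · simp [h]
  · exact Nat.zero_le _

end WeightedOrientedGraph

/-! ### Capacitated matchings in bipartite graphs -/

theorem card_filter_sigma_fst_le {ι γ : Type*} [Fintype ι] [DecidableEq γ] (k : γ → ℕ)
    (m : ι → Σ y, Fin (k y)) (hm : Function.Injective m) (y : γ) :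
    (Finset.univ.filter fun i => (m i).1 = y).card ≤ k y := by
  classical
  rw [← Finset.card_image_of_injective _ hm]
  calc _ ≤ ((Finset.univ : Finset (Fin (k y))).image
        (Sigma.mk (β := fun y => Fin (k y)) y)).card := by
        refine Finset.card_le_card fun z hz => ?_
        obtain ⟨i, hi, rfl⟩ := Finset.mem_image.1 hz
        have hy : (m i).1 = y := (Finset.mem_filter.1 hi).2
        subst hy
        exact Finset.mem_image_of_mem _ (Finset.mem_univ (m i).2)
    _ ≤ k y := Finset.card_image_le.trans (by simp)

/-- The weighted version of König's theorem, in the direction that produces a matching: if every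
vertex cover of a bipartite graph has capacity at least `n`, then there are `n` edges, possibly
repeated, that meet every vertex at most as often as its capacity allows. -/
theorem exists_capacitated_matching {α β : Type*} [Fintype α] [Fintype β] [DecidableEq α]
    [DecidableEq β] (r : α → β → Prop) (b : α → ℕ) (c : β → ℕ) (n : ℕ)
    (h : ∀ (A : Finset α) (B : Finset β), (∀ x y, r x y → x ∈ A ∨ y ∈ B) →
      n ≤ ∑ x ∈ A, b x + ∑ y ∈ B, c y) :
    ∃ e : Fin n → α × β, (∀ i, r (e i).1 (e i).2) ∧
      (∀ x, (Finset.univ.filter fun i => (e i).1 = x).card ≤ b x) ∧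
      ∀ y, (Finset.univ.filter fun i => (e i).2 = y).card ≤ c y := by
  classical
  let L := Σ x, Fin (b x)
  let R := Σ y, Fin (c y)
  have hL : Fintype.card L = ∑ x, b x := by simp [L]
  have hn : n ≤ Fintype.card L := by
    rw [hL]; simpa using h Finset.univ ∅ (by simp)
  -- Each vertex is split into as many copies as its capacity. The `d` dummy vertices, adjacent to
  -- every left copy, absorb the deficiency in Hall's theorem; at least `n` left copies then get
  -- genuine partners.
  let d := Fintype.card L - n
  let t : L → Finset (R ⊕ Fin d) := fun l =>
    (Finset.univ.filter fun q : R => r l.1 q.1).disjSum Finset.univ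
  have hall : ∀ S : Finset L, S.card ≤ (S.biUnion t).card := by
    intro S
    rcases S.eq_empty_or_nonempty with rfl | ⟨l₀, hl₀⟩
    · simp
    -- Hall's condition for `S` comes from the cover made of the left vertices with no copy in `S`
    -- and the neighbours of `S`.
    let A : Finset α := Finset.univ.filter fun x => ∀ i, (⟨x, i⟩ : L) ∉ S
    let B : Finset β := Finset.univ.filter fun y => ∃ l ∈ S, r l.1 y
    have hcov := h A B fun x y hxy => by
      by_cases hx : x ∈ A
      · exact Or.inl hx
      · right
        simp only [A, Finset.mem_filter, Finset.mem_univ, true_and, not_forall, not_not] at hx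
        obtain ⟨i, hi⟩ := hx
        simpa [B] using ⟨_, hi, hxy⟩
    have h1 : S.card + ∑ x ∈ A, b x ≤ Fintype.card L := by
      have : (A.sigma fun x => (Finset.univ : Finset (Fin (b x)))).card = ∑ x ∈ A, b x := by
        simp [Finset.card_sigma]
      rw [← this, ← Finset.card_union_of_disjoint]
      · exact Finset.card_le_univ _
      · rw [Finset.disjoint_left]
        rintro ⟨x, i⟩ hS hA
        exact (Finset.mem_filter.1 (Finset.mem_sigma.1 hA).1).2 i hS
    have h2 : ∑ y ∈ B, c y + d ≤ (S.biUnion t).card := by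
      have : ((B.sigma fun y => (Finset.univ : Finset (Fin (c y)))).disjSum
          (Finset.univ : Finset (Fin d))).card = ∑ y ∈ B, c y + d := by
        simp [Finset.card_disjSum, Finset.card_sigma]
      rw [← this]
      refine Finset.card_le_card ?_
      rintro (⟨y, i⟩ | j) hq
      · obtain ⟨l, hl, hly⟩ := (Finset.mem_filter.1
          (Finset.mem_sigma.1 (Finset.inl_mem_disjSum.1 hq)).1).2
        exact Finset.mem_biUnion.2 ⟨l, hl, Finset.inl_mem_disjSum.2 (by simpa using hly)⟩
      · exact Finset.mem_biUnion.2 ⟨l₀, hl₀, Finset.inr_mem_disjSum.2 (Finset.mem_univ _)⟩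
    omega
  obtain ⟨f, hf, hft⟩ := (Finset.all_card_le_biUnion_card_iff_exists_injective t).1 hall
  let M : Finset L := Finset.univ.filter fun l => (f l).isLeft
  have hM : n ≤ M.card := by
    have h1 : (Finset.univ.filter fun l => ¬ (f l).isLeft).card ≤ d := by
      rw [← Finset.card_image_of_injective _ hf]
      calc _ ≤ ((Finset.univ : Finset (Fin d)).image (Sum.inr : Fin d → R ⊕ Fin d)).card := by
            refine Finset.card_le_card fun q hq => ?_
            obtain ⟨l, hl, rfl⟩ := Finset.mem_image.1 hq
            cases hfl : f l with
            | inl q => simp [hfl] at hl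
            | inr j => simp
        _ ≤ d := Finset.card_image_le.trans (by simp)
    have h2 : M.card + _ = _ := Finset.card_filter_add_card_filter_not fun l => (f l).isLeft
    rw [Finset.card_univ] at h2
    omega
  have hcard : Fintype.card (Fin n) ≤ Fintype.card M := by simpa using hM
  obtain ⟨g⟩ := Function.Embedding.nonempty_of_card_le hcard
  have hg : ∀ i, ∃ q : R, f (g i).1 = Sum.inl q := fun i =>
    Sum.isLeft_iff.1 (Finset.mem_filter.1 (g i).2).2
  choose q hq using hg
  have hginj : Function.Injective fun i => (g i).1 := Subtype.val_injective.comp g.injective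
  have hqinj : Function.Injective q := fun i j hij => hginj <| hf <| by
    simp only [hq, hij]
  refine ⟨fun i => ((g i).1.1, (q i).1), fun i => ?_,
    card_filter_sigma_fst_le b _ hginj, card_filter_sigma_fst_le c _ hqinj⟩
  have := hft (g i).1
  rw [hq, Finset.inl_mem_disjSum] at this
  exact (Finset.mem_filter.1 this).2

/-- The capacitated matching theorem for a graph with a proper two-colouring. -/
theorem SimpleGraph.IsBipartite.exists_capacitated_matching {V : Type*} [Fintype V]
    [DecidableEq V] {G : SimpleGraph V} (hG : G.IsBipartite) (b : V → ℕ) (n : ℕ)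
    (h : ∀ C : Finset V, (∀ u v, G.Adj u v → u ∈ C ∨ v ∈ C) → n ≤ ∑ v ∈ C, b v) :
    ∃ e : Fin n → V × V, (∀ i, G.Adj (e i).1 (e i).2) ∧
      ∀ v, ∑ i, ((if (e i).1 = v then 1 else 0) + (if (e i).2 = v then 1 else 0)) ≤ b v := by
  obtain ⟨col⟩ := hG
  obtain ⟨e, he, h1, h2⟩ := _root_.exists_capacitated_matching
    (fun x y => G.Adj x y ∧ col x = 0 ∧ col y = 1) b b n fun A B hAB => by
      refine (h (A.filter (col · = 0) ∪ B.filter (col · = 1)) fun u v huv => ?_).trans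
        (le_trans (Nat.le_add_right _ _) (Finset.sum_union_inter.trans_le (add_le_add
          (Finset.sum_le_sum_of_subset (Finset.filter_subset _ A))
          (Finset.sum_le_sum_of_subset (Finset.filter_subset _ B)))))
      simp only [Finset.mem_union, Finset.mem_filter]
      have hne := col.valid huv
      have h1 := hAB u v
      have h2 := hAB v u
      have huv' := huv.symm
      have h01 : ∀ c : Fin 2, c = 0 ∨ c = 1 := by decide
      rcases h01 (col u) with hu | hu <;> rcases h01 (col v) with hv | hv <;> grind
  refine ⟨e, fun i => (he i).1, fun v => ?_⟩
  rw [Finset.sum_add_distrib, ← Finset.card_filter, ← Finset.card_filter]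
  by_cases hv : col v = 0
  · rw [Finset.filter_false_of_mem (s := Finset.univ) (p := fun i => (e i).2 = v)]
    · simpa using h1 v
    · rintro i - rfl
      simp [(he i).2.2] at hv
  · rw [Finset.filter_false_of_mem (s := Finset.univ) (p := fun i => (e i).1 = v)]
    · simpa using h2 v
    · rintro i - rfl
      exact hv (he i).2.1

/-! ### Comparison of ordinary and symbolic powers -/

namespace WeightedOrientedGraph

open MvPolynomial

variable {V : Type*} {D : WeightedOrientedGraph V} {K : Type*} [Field K]

theorem symbolicPower_le_pow [Finite V] (hw : ∀ u v, D.Edge u v → D.weight u = 1)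
    (hG : D.underlyingGraph.IsBipartite) (n : ℕ) :
    symbolicPower (D.edgeIdeal K) n ≤ D.edgeIdeal K ^ n := by
  classical
  have := Fintype.ofFinite V
  intro f hf
  rw [mem_edgeIdeal_pow]
  intro a ha
  obtain ⟨e, he, hea⟩ := hG.exists_capacitated_matching (fun v => a v / D.weight v) n
    fun C hC => le_sum_div_of_mem_symbolicPower hw hf C (fun u v huv => hC u v (Or.inl huv)) a ha
  -- The matching ignores directions; restoring them is harmless because the exponent of a generator
  -- is symmetric in its two ends under `hw`.
  let e' : Fin n → V × V := fun i => if D.Edge (e i).1 (e i).2 then e i else (e i).swap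
  have he' : ∀ i, D.Edge (e' i).1 (e' i).2 := fun i => by
    simp only [e']
    split_ifs with h
    · exact h
    · exact (he i).resolve_left h
  have hexp : ∀ i, D.edgeExponent (e' i) =
      Finsupp.single (e i).1 (D.weight (e i).1) + Finsupp.single (e i).2 (D.weight (e i).2) :=
    fun i => by
      rw [edgeExponent_eq hw (he' i)]
      simp only [e']
      split_ifs with h
      · rfl
      · exact add_comm _ _
  refine ⟨e', he', fun v => ?_⟩
  calc (∑ i, D.edgeExponent (e' i)) v
      = (∑ i, ((if (e i).1 = v then 1 else 0) + (if (e i).2 = v then 1 else 0))) *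
          D.weight v := by
        rw [Finsupp.finsetSum_apply, Finset.sum_mul]
        refine Finset.sum_congr rfl fun i _ => ?_
        rw [hexp, Finsupp.add_apply, Finsupp.single_apply, Finsupp.single_apply, add_mul]
        congr 1 <;> split_ifs with h <;> simp [h]
    _ ≤ a v / D.weight v * D.weight v := Nat.mul_le_mul_right _ (hea v)
    _ ≤ a v := Nat.div_mul_le_self _ _

/-- Locally at `p`, if `t_u ∈ p` then `t_u ^ w(u)` lies in the ideal and supplies `w(v) - 1`
factors, the edge `x → v` the last one. If `t_u ∉ p`, then `t_v` itself lies in the ideal, thanks to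
`v → u`. -/
theorem mul_pow_mul_pow_mem_symbolicPower {x v u : V} (hxv : D.Edge x v) (hvu : D.Edge v u) :
    X x * X v ^ D.weight v * (X u ^ D.weight u) ^ (D.weight v - 1) ∈
      symbolicPower (D.edgeIdeal K) (D.weight v) := by
  rw [mem_symbolicPower]
  intro p hp
  have := hp.1.1
  rw [← mem_localContraction]
  by_cases hu : (X u : MvPolynomial V K) ∈ p
  · have h1 : (X x * X v ^ D.weight v : MvPolynomial V K) ∈
        localContraction (D.edgeIdeal K ^ 1) p :=
      mem_localContraction.2 ⟨1, p.primeCompl.one_mem, by simpa using mul_mem_edgeIdeal hxv⟩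
    have := localContraction_pow_mul_mem h1
      (localContraction_pow_mem (X_pow_mem_localContraction hp hu) (D.weight v - 1))
    rwa [Nat.add_sub_cancel' (D.weight_pos v)] at this
  · exact Ideal.mul_mem_right _ _ (Ideal.mul_mem_left _ _
      (localContraction_pow_mem (X_mem_localContraction hvu hu) _))

/-- The edge `x → v` would exhaust `t_x` and `t_v`, leaving only a loop at `u` for a second factor.
Every factor therefore either ends in `u`, costing `t_u ^ w(u)`, or is `u → x`, which occurs at most
once and still costs one `t_u`. Both ways the `w(v)` factors need more than `w(u) * (w(v) - 1)`
copies of `t_u`. -/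
theorem mul_pow_mul_pow_notMem_pow {x v u : V} (hxv : D.Edge x v) (hvu : D.Edge v u)
    (hv : 1 < D.weight v) :
    (X x * X v ^ D.weight v * (X u ^ D.weight u) ^ (D.weight v - 1) : MvPolynomial V K) ∉
      D.edgeIdeal K ^ D.weight v := by
  classical
  have hloop : ∀ {y z}, D.Edge y z → y ≠ z := fun {y z} h hyz =>
    D.asymm y z h (hyz ▸ hyz ▸ h)
  have hxv' := hloop hxv
  have hvu' := hloop hvu
  have hxu : x ≠ u := fun h => D.asymm v u hvu (h ▸ hxv)
  set q := D.weight v with hq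
  set r := D.weight u with hr
  let a : V →₀ ℕ := Finsupp.single x 1 + Finsupp.single v q + Finsupp.single u (r * (q - 1))
  have hmon : (X x * X v ^ q * (X u ^ r) ^ (q - 1) : MvPolynomial V K) = monomial a 1 := by
    rw [← pow_mul, X_pow_eq_monomial, X_pow_eq_monomial, X, monomial_mul, monomial_mul]
    simp [a]
  rw [hmon, monomial_mem_edgeIdeal_pow]
  rintro ⟨e, he, hea⟩
  have hax : a x = 1 := by simp [a, hxv'.symm, hxu.symm]
  have hav : a v = q := by simp [a, hxv', hvu'.symm]
  have hau : a u = r * (q - 1) := by simp [a, hxu, hvu']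
  have hsum : ∀ y, ∑ i, D.edgeExponent (e i) y ≤ a y := fun y => by
    rw [← Finsupp.finsetSum_apply]; exact hea y
  have hone : ∀ i y, D.edgeExponent (e i) y ≤ a y := fun i y =>
    (Finset.single_le_sum (f := fun i => D.edgeExponent (e i) y) (fun _ _ => Nat.zero_le _)
      (Finset.mem_univ i)).trans (hsum y)
  have htwo : ∀ i j y, i ≠ j → D.edgeExponent (e i) y + D.edgeExponent (e j) y ≤ a y :=
    fun i j y hij => by
      rw [← Finset.sum_pair (f := fun i => D.edgeExponent (e i) y) hij]
      exact (Finset.sum_le_sum_of_subset (Finset.subset_univ _)).trans (hsum y)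
  have hfst : ∀ i, 1 ≤ D.edgeExponent (e i) (e i).1 := fun i => by simp [edgeExponent]
  have hsnd : ∀ i, D.weight (e i).2 ≤ D.edgeExponent (e i) (e i).2 := fun i => by
    simp [edgeExponent]
  have hsupp : ∀ y, 1 ≤ a y → y = x ∨ y = v ∨ y = u := fun y hy => by
    by_contra! h
    simp [a, h.1.symm, h.2.1.symm, h.2.2.symm] at hy
  have hend1 : ∀ i, (e i).1 = x ∨ (e i).1 = v ∨ (e i).1 = u := fun i =>
    hsupp _ ((hfst i).trans (hone i _))
  have hend2 : ∀ i, (e i).2 = x ∨ (e i).2 = v ∨ (e i).2 = u := fun i =>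
    hsupp _ ((D.weight_pos _).trans ((hsnd i).trans (hone i _)))
  have hnot : ∀ i, ¬ ((e i).1 = x ∧ (e i).2 = v) := by
    rintro i ⟨h1, h2⟩
    obtain ⟨j, hj⟩ : ∃ j, i ≠ j := by
      have : Nontrivial (Fin q) := Fin.nontrivial_iff_two_le.2 hv
      exact (exists_ne i).imp fun _ => Ne.symm
    have hx := htwo i j x hj
    have hv' := htwo i j v hj
    have hix := hfst i
    have hiv := hsnd i
    rw [h1] at hix
    rw [h2] at hiv
    have hj1 := hfst j
    have hj2 := (D.weight_pos _).trans (hsnd j)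
    have hj3 := hloop (he j)
    have h1u : (e j).1 = u := by
      rcases hend1 j with h | h | h
      · rw [h] at hj1; omega
      · rw [h] at hj1; omega
      · exact h
    have h2u : (e j).2 = u := by
      rcases hend2 j with h | h | h
      · rw [h] at hj2; omega
      · rw [h] at hj2; omega
      · exact h
    exact hj3 (h1u.trans h2u.symm)
  have hcase : ∀ i, (e i).2 = u ∨ ((e i).1 = u ∧ (e i).2 = x) := fun i => by
    have h0 := he i
    have h1 := hend1 i
    have h2 := hend2 i
    have h3 := hloop h0
    have h4 := hnot i
    have h5 : ¬ ((e i).1 = v ∧ (e i).2 = x) := fun h => D.asymm _ _ hxv (h.1 ▸ h.2 ▸ h0)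
    have h6 : ¬ ((e i).1 = u ∧ (e i).2 = v) := fun h => D.asymm _ _ hvu (h.1 ▸ h.2 ▸ h0)
    rcases h1 with h1 | h1 | h1 <;> rcases h2 with h2 | h2 | h2 <;> simp_all
  have hru : ∀ i, (e i).2 = u → r ≤ D.edgeExponent (e i) u := fun i hi => by
    have := hsnd i
    rwa [hi] at this
  have hrpos : 1 ≤ r := D.weight_pos u
  have hsu := hsum u
  have hq1 : r * (q - 1) + r = r * q := by
    rw [← Nat.mul_succ, Nat.succ_eq_add_one, Nat.sub_add_cancel hv.le]
  by_cases hall : ∀ i, (e i).2 = u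
  · have : ∑ _i : Fin q, r ≤ ∑ i, D.edgeExponent (e i) u :=
      Finset.sum_le_sum fun i _ => hru i (hall i)
    rw [Finset.sum_const, Finset.card_univ, Fintype.card_fin, smul_eq_mul, mul_comm] at this
    omega
  · push Not at hall
    obtain ⟨i, hi⟩ := hall
    obtain ⟨hiu, hix⟩ := (hcase i).resolve_left hi
    have hothers : ∀ j ∈ Finset.univ.erase i, r ≤ D.edgeExponent (e j) u := fun j hj => by
      refine hru j ((hcase j).resolve_right fun h => ?_)
      have h1 := htwo j i x (Finset.ne_of_mem_erase hj)
      have h2 := (D.weight_pos _).trans (hsnd j)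
      have h3 := (D.weight_pos _).trans (hsnd i)
      rw [h.2] at h2
      rw [hix] at h3
      omega
    have h1 := Finset.sum_le_sum hothers
    have h2 := Finset.add_sum_erase Finset.univ (fun i => D.edgeExponent (e i) u)
      (Finset.mem_univ i)
    have h3 := hfst i
    rw [hiu] at h3
    rw [Finset.sum_const, Finset.card_erase_of_mem (Finset.mem_univ i), Finset.card_univ,
      Fintype.card_fin, smul_eq_mul, mul_comm] at h1
    omega

theorem prod_range_mem_symbolicPower {g : ℕ → V} {L : ℕ}
    (hadj : ∀ i < L, D.underlyingGraph.Adj (g i) (g (i + 1))) (hclosed : g L = g 0) :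
    ∏ i ∈ Finset.range L, (X (g i) : MvPolynomial V K) ^ D.weight (g i) ∈
      symbolicPower (D.edgeIdeal K) ((L + 1) / 2) := by
  classical
  rw [mem_symbolicPower]
  intro p hp
  have := hp.1.1
  rw [← mem_localContraction]
  let k : ℕ → ℕ := fun i => if (X (g i) : MvPolynomial V K) ∈ p then 1 else 0
  have hmem := localContraction_prod_mem (I := D.edgeIdeal K) (p := p) (Finset.range L) k
    (fun i => (X (g i) : MvPolynomial V K) ^ D.weight (g i)) fun i _ => by
      by_cases h : (X (g i) : MvPolynomial V K) ∈ p
      · simpa [k, h] using X_pow_mem_localContraction hp h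
      · rw [show k i = 0 from if_neg h]
        simpa using Ideal.mul_mem_left _ (X (g i) ^ D.weight (g i))
          (one_mem_localContraction_pow_zero (I := D.edgeIdeal K) (p := p))
  refine localContraction_pow_antitone ?_ hmem
  -- Each step of the walk has an end in `p`, and going round counts every position twice, so at
  -- least half of the `L` positions, rounded up, lie in `p`.
  have h1 : L ≤ ∑ i ∈ Finset.range L, (k i + k (i + 1)) := by
    refine le_trans (b := ∑ i ∈ Finset.range L, 1) (by simp) (Finset.sum_le_sum fun i hi => ?_)
    have : (X (g i) : MvPolynomial V K) ∈ p ∨ (X (g (i + 1)) : MvPolynomial V K) ∈ p :=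
      (hadj i (Finset.mem_range.1 hi)).elim (X_mem_or_X_mem hp)
        fun h => (X_mem_or_X_mem hp h).symm
    rcases this with h | h <;> simp [k, h]
  have h2 := (Finset.sum_range_succ k L).symm.trans (Finset.sum_range_succ' k L)
  have h3 : k L = k 0 := by simp [k, hclosed]
  rw [Finset.sum_add_distrib] at h1
  omega

theorem prod_range_notMem_pow (hw : ∀ u v, D.Edge u v → D.weight u = 1) (g : ℕ → V) {L n : ℕ}
    (hL : L < 2 * n) :
    ∏ i ∈ Finset.range L, (X (g i) : MvPolynomial V K) ^ D.weight (g i) ∉ D.edgeIdeal K ^ n := by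
  simp_rw [X_pow_eq_monomial]
  rw [← monomial_sum_one, monomial_mem_edgeIdeal_pow]
  rintro ⟨e, he, hea⟩
  -- With `t_v` in degree `1 / w(v)`, every generator has degree 2, while the product has degree `L
  -- < 2 * n`.
  let ψ := Finsupp.weight (R := ℕ) fun v => (1 / D.weight v : ℚ)
  have hψ : ∀ v, ψ (Finsupp.single v (D.weight v)) = 1 := fun v => by
    have : (D.weight v : ℚ) ≠ 0 := by exact_mod_cast Nat.pos_iff_ne_zero.1 (D.weight_pos v)
    simp [ψ, Finsupp.weight_single, this]
  obtain ⟨c, hc⟩ := exists_add_of_le hea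
  have hc0 : 0 ≤ ψ c := by
    rw [Finsupp.weight_apply]
    exact Finset.sum_nonneg fun v _ => by positivity
  have h := congrArg ψ hc
  have he2 : ∀ i, ψ (D.edgeExponent (e i)) = 1 + 1 := fun i => by
    rw [edgeExponent_eq hw (he i), map_add, hψ, hψ]
  simp only [map_add, map_sum, hψ, he2, Finset.sum_const, Finset.card_range, Finset.card_univ,
    Fintype.card_fin, nsmul_eq_mul] at h
  have : (L : ℚ) < 2 * n := by exact_mod_cast hL
  linarith

theorem weight_eq_one_of_edge (h : ∀ v ∈ D.heavyVertices, D.IsSink v) {u v : V}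
    (huv : D.Edge u v) : D.weight u = 1 :=
  le_antisymm (not_lt.1 fun hu => h u hu v huv) (D.weight_pos u)

end WeightedOrientedGraph

open WeightedOrientedGraph in
theorem theorem3p3 {V : Type*} [Finite V] {K : Type*} [Field K] (D : WeightedOrientedGraph V)
    (hsource : ∀ v, D.IsSource v → ¬ D.IsSink v → D.weight v = 1) :
    (∀ n : ℕ, 1 ≤ n → D.edgeIdeal K ^ n = symbolicPower (D.edgeIdeal K) n) ↔
      ((∀ v ∈ D.heavyVertices, D.IsSink v) ∧ D.underlyingGraph.IsBipartite) := by
  constructor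
  · intro h
    have hsink : ∀ v ∈ D.heavyVertices, D.IsSink v := by
      intro v hv u hvu
      -- The convention on sources supplies the edge `x → v` that completes the path.
      have hns : ¬ D.IsSource v := fun hs => (ne_of_gt hv) (hsource v hs fun h => h u hvu)
      simp only [IsSource, not_forall, not_not] at hns
      obtain ⟨x, hxv⟩ := hns
      refine mul_pow_mul_pow_notMem_pow (K := K) hxv hvu hv ?_
      rw [h _ (D.weight_pos v)]
      exact mul_pow_mul_pow_mem_symbolicPower hxv hvu
    refine ⟨hsink, SimpleGraph.two_colorable_iff_forall_loop_even.2 fun u w => ?_⟩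
    by_contra hodd
    rw [Nat.not_even_iff_odd] at hodd
    obtain ⟨m, hm⟩ := hodd
    refine prod_range_notMem_pow (K := K) (fun _ _ => weight_eq_one_of_edge hsink) w.getVert
      (L := w.length) (n := (w.length + 1) / 2) (by omega) ?_
    rw [h _ (by omega)]
    exact prod_range_mem_symbolicPower (fun i hi => w.adj_getVert_succ hi) (by simp)
  · rintro ⟨hsink, hG⟩ n -
    exact le_antisymm (pow_le_symbolicPower _ _)
      (symbolicPower_le_pow (fun _ _ => weight_eq_one_of_edge hsink) hG n)
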